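/- Let $\mathbb{D}$ be the open unit disk, let $H^2$ be the Hardy space of $\mathbb{D}$ with norm $\|f\| = \sup_{0\le r<1}\bigl(\frac{1}{2\pi}\int_0^{2\pi}|f(re^{i\theta})|^2\,d\theta\bigr)^{1/2}$ (equivalently, the $L^2$ norm, with respect to normalized arc length, of the boundary function on $\partial\mathbb{D}$) and the corresponding inner product, and let $H^\infty$ be the set of bounded analytic functions on $\mathbb{D}$ with norm $\|f\|_\infty = \sup_{z\in\mathbb{D}}|f(z)|$. An inner function is a function in $H^\infty$ whose radial limits exist and have modulus one at almost every point of $\partial\mathbb{D}$. For an inner function $\Theta$ let $K_\Theta = H^2\cap(\Theta H^2)^\perp$ and $K_\Theta^\infty = K_\Theta\cap H^\infty$. If $\Theta$ is an inner function, then $$\|\varphi\| \le (1-|\Theta(0)|^2)^{1/2}\,\|\varphi\|_\infty \qquad\text{for all } \varphi\in K_\Theta^\infty .$$ If moreover $\Theta$ is a finite Blaschke product, then for $\varphi\in K_\Theta^\infty$ equality holds if and only if $\varphi = 0$ or $\varphi$ is a scalar multiple of an inner function belonging to $K_\Theta$. -/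

import Mathlib

open Complex Set Filter Topology MeasureTheory
open scoped ComplexConjugate

namespace ModelSpace

/-- The open unit disk. Functions on the disk are represented by functions `ℂ → ℂ`; all notions
below depend only on the values on the open disk. -/
def disk : Set ℂ := Metric.ball (0 : ℂ) 1

/-- The classical Hardy space `H²` of the disk: analytic functions on the disk whose quadratic
integral means `(1 / 2π) ∫ |f (r e^{iθ})|² dθ` are bounded for `0 ≤ r < 1`. -/
def hardyTwo : Set (ℂ → ℂ) :=
  {f | DifferentiableOn ℂ f disk ∧
    ∃ C : ℝ, ∀ r : ℝ, 0 ≤ r → r < 1 → Real.circleAverage (fun z => ‖f z‖ ^ 2) 0 r ≤ C}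

/-- The `H²` norm `sup_{0 ≤ r < 1} ((1 / 2π) ∫ |f (r e^{iθ})|² dθ)^{1/2}`, which is the `L²` norm
of the boundary function for `f` in `H²`. -/
noncomputable def hardyNorm (f : ℂ → ℂ) : ℝ :=
  ⨆ r : Ico (0 : ℝ) 1, √(Real.circleAverage (fun z => ‖f z‖ ^ 2) 0 (r : ℝ))

/-- Orthogonality in `H²`: the inner product
`⟨f, g⟩ = lim_{r → 1⁻} (1 / 2π) ∫ f (r e^{iθ}) conj (g (r e^{iθ})) dθ` vanishes. -/
def HardyOrthogonal (f g : ℂ → ℂ) : Prop :=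
  Tendsto (fun r : ℝ => Real.circleAverage (fun z => f z * conj (g z)) 0 r) (𝓝[<] 1) (𝓝 0)

/-- `H^∞`: the bounded analytic functions on the disk. -/
def hardyInfty : Set (ℂ → ℂ) :=
  {f | DifferentiableOn ℂ f disk ∧ ∃ C : ℝ, ∀ z ∈ disk, ‖f z‖ ≤ C}

/-- The `H^∞` norm, the supremum of `|f|` over the disk. -/
noncomputable def supNorm (f : ℂ → ℂ) : ℝ := ⨆ z : disk, ‖f z‖

/-- Inner functions: bounded analytic functions on the disk whose radial limits exist and have
modulus one at almost every point `e^{iθ}` of the unit circle. -/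
def IsInner (f : ℂ → ℂ) : Prop :=
  f ∈ hardyInfty ∧
    ∀ᵐ θ : ℝ, ∃ w : ℂ, ‖w‖ = 1 ∧ Tendsto (fun r : ℝ => f (circleMap 0 r θ)) (𝓝[<] 1) (𝓝 w)

/-- The model space `K_Θ = H² ∩ (Θ H²)^⊥`. -/
def modelSpace (Θ : ℂ → ℂ) : Set (ℂ → ℂ) :=
  {f | f ∈ hardyTwo ∧ ∀ h ∈ hardyTwo, HardyOrthogonal f (fun z => Θ z * h z)}

/-- Finite Blaschke products, with zeros repeated according to multiplicity; the empty product,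
a unimodular constant, is included. -/
def IsFiniteBlaschkeProduct (Θ : ℂ → ℂ) : Prop :=
  ∃ (n : ℕ) (a : Fin n → ℂ) (c : ℂ), (∀ i, a i ∈ disk) ∧ ‖c‖ = 1 ∧
    ∀ z ∈ disk, Θ z = c * ∏ i, (z - a i) / (1 - conj (a i) * z)

end ModelSpace

namespace ModelSpace

/-! Write M = ‖φ‖_∞ and t = |Θ(0)|. Since φ is bounded it lies in H², so φ ⊥ Θφ, which says that
|φ|² conj Θ has mean zero on the boundary. The mean of (M² - |φ|²) conj Θ is therefore M² conj Θ(0).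
As |Θ| ≤ 1 and M² - |φ|² ≥ 0, this gives M² t ≤ M² - ‖φ‖², that is ‖φ‖² ≤ (1 - t) M²
(`hardyNorm_sq_le`), which is stronger than the claim because t² ≤ t.

Equality in the weaker bound with M ≠ 0 forces t = t². If t = 1, then ‖φ‖ = 0. If t = 0, then ‖φ‖ =
M; for a finite Blaschke product φ is rational with poles off the closed disk
(`exists_continuousOn_closedBall`), so |φ| = M everywhere on the circle and φ / M is inner.
Conversely, an inner u in K_Θ has ‖u‖ = ‖u‖_∞ = 1, so the stronger bound gives Θ(0) = 0, and
equality holds for multiples of u. -/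

/-! ### Circle averages and Cauchy estimates. -/

lemma sphere_subset_disk {r : ℝ} (h0 : 0 ≤ r) (h1 : r < 1) :
    Metric.sphere (0 : ℂ) |r| ⊆ disk := by
  intro z hz
  rw [abs_of_nonneg h0, mem_sphere_zero_iff_norm] at hz
  simpa [disk, hz] using h1

lemma circleMap_mem_disk {r : ℝ} (h0 : 0 ≤ r) (h1 : r < 1) (θ : ℝ) : circleMap 0 r θ ∈ disk :=
  sphere_subset_disk h0 h1 (circleMap_mem_sphere' 0 r θ)

lemma eventually_mem_Ioo {a : ℝ} (ha : a < 1) : ∀ᶠ r : ℝ in 𝓝[<] 1, r ∈ Ioo a 1 :=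
  Ioo_mem_nhdsLT ha

/-- Dominated convergence for circle averages over varying circles. -/
lemma tendsto_circleAverage_of_bounded {ι E : Type*} [NormedAddCommGroup E] [NormedSpace ℝ E]
    {l : Filter ι} [l.IsCountablyGenerated] {F : ι → ℂ → E} {ρ : ι → ℝ} {L : ℝ → E} (C : ℝ)
    (hF : ∀ᶠ i in l, ContinuousOn (F i) (Metric.sphere 0 |ρ i|))
    (hb : ∀ᶠ i in l, ∀ z ∈ Metric.sphere (0 : ℂ) |ρ i|, ‖F i z‖ ≤ C)
    (hL : ∀ᵐ θ : ℝ, Tendsto (fun i => F i (circleMap 0 (ρ i) θ)) l (𝓝 (L θ))) :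
    Tendsto (fun i => Real.circleAverage (F i) 0 (ρ i)) l
      (𝓝 ((2 * Real.pi)⁻¹ • ∫ θ in 0..2 * Real.pi, L θ)) := by
  refine Tendsto.const_smul ?_ _
  refine intervalIntegral.tendsto_integral_filter_of_dominated_convergence (fun _ => C) ?_ ?_ ?_ ?_
  · filter_upwards [hF] with i hi
    refine (hi.comp_continuous (continuous_circleMap 0 (ρ i)) fun θ => ?_).aestronglyMeasurable
    exact circleMap_mem_sphere' 0 (ρ i) θ
  · filter_upwards [hb] with i hi
    exact ae_of_all _ fun θ _ => hi _ (circleMap_mem_sphere' 0 (ρ i) θ)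
  · exact intervalIntegrable_const
  · filter_upwards [hL] with θ h _ using h

lemma norm_circleAverage_le {E : Type*} [NormedAddCommGroup E] [NormedSpace ℝ E]
    (f : ℂ → E) (c : ℂ) (r : ℝ) :
    ‖Real.circleAverage f c r‖ ≤ Real.circleAverage (fun z => ‖f z‖) c r := by
  rw [Real.circleAverage, Real.circleAverage, norm_smul, smul_eq_mul, Real.norm_eq_abs,
    abs_of_pos (inv_pos.2 Real.two_pi_pos)]
  gcongr
  exact intervalIntegral.norm_integral_le_integral_norm Real.two_pi_pos.le

lemma circleIntegrable_of_continuousOn_disk {E : Type*} [NormedAddCommGroup E]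
    {f : ℂ → E} (hf : ContinuousOn f disk) {r : ℝ} (h0 : 0 ≤ r) (h1 : r < 1) :
    CircleIntegrable f 0 r :=
  (hf.mono (sphere_subset_disk h0 h1)).circleIntegrable'

lemma closedBall_subset_disk {r : ℝ} (h1 : r < 1) : Metric.closedBall (0 : ℂ) r ⊆ disk :=
  Metric.closedBall_subset_ball h1

lemma diffContOnCl_ball {f : ℂ → ℂ} (hf : DifferentiableOn ℂ f disk) {r : ℝ} (h1 : r < 1) :
    DiffContOnCl ℂ f (Metric.ball 0 r) :=
  (hf.mono (Metric.closure_ball_subset_closedBall.trans (closedBall_subset_disk h1))).diffContOnCl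

/-- Cauchy's formula writes `f z` as the average of `w / (w - z) * f w`, and `|w - z| ≥ r - ‖z‖` on
the circle. -/
lemma norm_le_circleAverage_norm {f : ℂ → ℂ} (hf : DifferentiableOn ℂ f disk) {z : ℂ} {r : ℝ}
    (hz : ‖z‖ < r) (h1 : r < 1) :
    ‖f z‖ ≤ r / (r - ‖z‖) * Real.circleAverage (fun w => ‖f w‖) 0 r := by
  have h0 : 0 < r := (norm_nonneg z).trans_lt hz
  have habs : |r| = r := abs_of_pos h0
  have hcont := hf.continuousOn.mono (sphere_subset_disk h0.le h1)
  have hne : ∀ w ∈ Metric.sphere (0 : ℂ) |r|, r - ‖z‖ ≤ ‖w - z‖ := by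
    intro w hw
    rw [habs, mem_sphere_zero_iff_norm] at hw
    simpa [hw] using norm_sub_norm_le w z
  have key := DiffContOnCl.circleAverage_smul_div (c := 0) (R := r) (w := z) (f := f)
    (by rw [habs]; exact diffContOnCl_ball hf h1) (by simpa [habs] using hz)
  rw [← key, ← smul_eq_mul, ← Real.circleAverage_fun_smul]
  refine (norm_circleAverage_le _ _ _).trans (Real.circleAverage_mono ?_ ?_ ?_)
  · refine ContinuousOn.circleIntegrable' (ContinuousOn.norm (ContinuousOn.fun_smul ?_ hcont))
    refine ContinuousOn.div (by fun_prop) (by fun_prop) fun w hw h => ?_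
    have := hne w hw
    rw [h, norm_zero] at this
    linarith
  · exact ContinuousOn.circleIntegrable' (hcont.norm.fun_const_smul _)
  · intro w hw
    have h2 := hne w hw
    rw [habs, mem_sphere_zero_iff_norm] at hw
    rw [norm_smul, norm_div, smul_eq_mul, sub_zero, hw]
    gcongr

lemma norm_pow_le_circleAverage {f : ℂ → ℂ} (hf : DifferentiableOn ℂ f disk) {z : ℂ} {r : ℝ}
    (hz : ‖z‖ < r) (h1 : r < 1) (n : ℕ) :
    ‖f z‖ ^ n ≤ r / (r - ‖z‖) * Real.circleAverage (fun w => ‖f w‖ ^ n) 0 r := by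
  simpa [norm_pow] using norm_le_circleAverage_norm (hf.pow n) hz h1

/-! ### Inner functions are bounded by one. -/

lemma IsInner.tendsto_circleAverage {u : ℂ → ℂ} (hu : IsInner u) (n : ℕ) :
    Tendsto (fun r : ℝ => Real.circleAverage (fun z => ‖u z‖ ^ n) 0 r) (𝓝[<] 1) (𝓝 1) := by
  obtain ⟨⟨hd, C, hC⟩, hlim⟩ := hu
  have := tendsto_circleAverage_of_bounded (l := 𝓝[<] (1 : ℝ)) (F := fun _ z => ‖u z‖ ^ n)
    (ρ := id) (L := fun _ => (1 : ℝ)) (C ^ n) ?_ ?_ ?_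
  · have h2 : (2 * Real.pi)⁻¹ • ∫ _θ in 0..2 * Real.pi, (1 : ℝ) = 1 := by
      simp
      field_simp
    rwa [h2] at this
  · filter_upwards [eventually_mem_Ioo zero_lt_one] with r hr
    exact (hd.continuousOn.mono (sphere_subset_disk hr.1.le hr.2)).norm.pow n
  · filter_upwards [eventually_mem_Ioo zero_lt_one] with r hr z hz
    rw [norm_pow, norm_norm]
    gcongr
    exact hC z (sphere_subset_disk hr.1.le hr.2 hz)
  · filter_upwards [hlim] with θ ⟨w, hw, h⟩
    simpa [hw] using h.norm.pow n

/-- The Cauchy estimate for `u ^ n`, as the radius tends to 1, bounds `‖u z‖ ^ n` by a constant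
independent of `n`; this is impossible if `‖u z‖ > 1`. -/
lemma IsInner.norm_le_one {u : ℂ → ℂ} (hu : IsInner u) {z : ℂ} (hz : z ∈ disk) : ‖u z‖ ≤ 1 := by
  have hz1 : ‖z‖ < 1 := by simpa [disk] using hz
  have hbound : ∀ n : ℕ, ‖u z‖ ^ n ≤ 1 / (1 - ‖z‖) := by
    intro n
    have h1 : Tendsto (fun r : ℝ => r / (r - ‖z‖) *
        Real.circleAverage (fun w => ‖u w‖ ^ n) 0 r) (𝓝[<] 1) (𝓝 (1 / (1 - ‖z‖) * 1)) := by
      refine Tendsto.mul ?_ (hu.tendsto_circleAverage n)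
      refine tendsto_nhdsWithin_of_tendsto_nhds ?_
      exact tendsto_id.div (tendsto_id.sub_const _) (sub_pos.2 hz1).ne'
    rw [mul_one] at h1
    refine ge_of_tendsto h1 ?_
    filter_upwards [eventually_mem_Ioo hz1] with r hr
    exact norm_pow_le_circleAverage hu.1.1 hr.1 hr.2 n
  by_contra! h
  obtain ⟨n, hn⟩ := ((tendsto_pow_atTop_atTop_of_one_lt h).eventually_gt_atTop _).exists
  exact absurd (hbound n) (not_le.2 hn)

/-! ### Monotonicity of the quadratic means. -/

open Polynomial in
lemma circleAverage_sq_polynomial (p : ℂ[X]) (r : ℝ) :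
    Real.circleAverage (fun z => ‖p.eval z‖ ^ 2) 0 r =
      ∑ i ∈ p.support, ‖p.coeff i‖ ^ 2 * (r ^ 2) ^ i := by
  rw [Real.circleAverage_eq_circleAverage_zero_one]
  have h := (p.comp (C (r : ℂ) * X)).sum_sq_norm_coeff_eq_circleAverage
  simp only [eval_comp, eval_mul, eval_C, eval_X] at h
  simp only [add_zero]
  rw [← h, Finset.sum_subset (s₂ := p.support)]
  · refine Finset.sum_congr rfl fun i _ => ?_
    rw [comp_C_mul_X_coeff, norm_mul, norm_pow, Complex.norm_real, mul_pow, ← pow_mul, mul_comm i,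
      pow_mul, Real.norm_eq_abs, sq_abs]
  · intro i hi
    rw [mem_support_iff, comp_C_mul_X_coeff] at hi
    exact mem_support_iff.2 (left_ne_zero_of_mul hi)
  · intro i _ hi
    rw [notMem_support_iff.1 hi]
    simp

open Polynomial in
/-- A function analytic in the disk is on each smaller disk a bounded limit of polynomials. -/
lemma exists_polynomial_tendsto {f : ℂ → ℂ} (hf : DifferentiableOn ℂ f disk) :
    ∃ p : ℕ → ℂ[X], (∀ z ∈ disk, Tendsto (fun n => (p n).eval z) atTop (𝓝 (f z))) ∧
      ∀ s : ℝ, 0 ≤ s → s < 1 → ∃ B : ℝ, ∀ n, ∀ z : ℂ, ‖z‖ ≤ s → ‖(p n).eval z‖ ≤ B := by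
  set c : ℕ → ℂ := fun n => (n.factorial : ℂ)⁻¹ * iteratedDeriv n f 0
  have hs : ∀ z ∈ disk, HasSum (fun n => c n * z ^ n) (f z) := by
    intro z hz
    convert! hasSum_taylorSeries_on_ball hf hz using 2 with n
    simp [c]
    ring
  refine ⟨fun n => ∑ i ∈ Finset.range n, Polynomial.C (c i) * X ^ i, fun z hz => ?_,
    fun s h0 h1 => ?_⟩
  · simpa [eval_finsetSum] using (hs z hz).tendsto_sum_nat
  · have hsum : Summable fun n => ‖c n * (s : ℂ) ^ n‖ :=
      (hs s (by simpa [disk, abs_of_nonneg h0] using h1)).summable.norm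
    refine ⟨∑' n, ‖c n * (s : ℂ) ^ n‖, fun n z hz => ?_⟩
    rw [eval_finsetSum]
    refine (norm_sum_le _ _).trans
      (le_trans ?_ (hsum.sum_le_tsum (Finset.range n) fun _ _ => norm_nonneg _))
    refine Finset.sum_le_sum fun i _ => ?_
    simp only [eval_mul, eval_C, eval_pow, eval_X, norm_mul, norm_pow, Complex.norm_real,
      Real.norm_eq_abs, abs_of_nonneg h0]
    gcongr

/-- By Parseval the mean of a polynomial is a power series in `r ^ 2` with nonnegative coefficients;
the general case is a limit of this one. -/
lemma circleAverage_sq_mono {f : ℂ → ℂ} (hf : DifferentiableOn ℂ f disk) {r s : ℝ} (h0 : 0 ≤ r)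
    (hrs : r ≤ s) (h1 : s < 1) :
    Real.circleAverage (fun z => ‖f z‖ ^ 2) 0 r ≤ Real.circleAverage (fun z => ‖f z‖ ^ 2) 0 s := by
  obtain ⟨p, hp, hb⟩ := exists_polynomial_tendsto hf
  have hlim : ∀ t : ℝ, 0 ≤ t → t < 1 →
      Tendsto (fun n => Real.circleAverage (fun z => ‖(p n).eval z‖ ^ 2) 0 t) atTop
        (𝓝 (Real.circleAverage (fun z => ‖f z‖ ^ 2) 0 t)) := by
    intro t ht0 ht1
    obtain ⟨B, hB⟩ := hb t ht0 ht1
    refine tendsto_circleAverage_of_bounded (ρ := fun _ => t) (B ^ 2)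
      (.of_forall fun n => by fun_prop) (.of_forall fun n z hz => ?_) (ae_of_all _ fun θ => ?_)
    · rw [abs_of_nonneg ht0, mem_sphere_zero_iff_norm] at hz
      rw [norm_pow, norm_norm]
      gcongr
      exact hB n z hz.le
    · exact ((hp _ (circleMap_mem_disk ht0 ht1 θ)).norm).pow 2
  refine le_of_tendsto_of_tendsto' (hlim r h0 (hrs.trans_lt h1)) (hlim s (h0.trans hrs) h1) ?_
  intro n
  rw [circleAverage_sq_polynomial, circleAverage_sq_polynomial]
  gcongr

/-! ### The Hardy and supremum norms. -/

lemma circleAverage_sq_nonneg (f : ℂ → ℂ) (r : ℝ) :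
    0 ≤ Real.circleAverage (fun z => ‖f z‖ ^ 2) 0 r :=
  Real.circleAverage_nonneg_of_nonneg fun _ _ => by positivity

lemma hardyNorm_nonneg (f : ℂ → ℂ) : 0 ≤ hardyNorm f :=
  Real.iSup_nonneg fun _ => Real.sqrt_nonneg _

lemma circleAverage_sq_le_hardyNorm {f : ℂ → ℂ} (hf : f ∈ hardyTwo) {r : ℝ} (h0 : 0 ≤ r)
    (h1 : r < 1) : Real.circleAverage (fun z => ‖f z‖ ^ 2) 0 r ≤ hardyNorm f ^ 2 := by
  obtain ⟨hd, C, hC⟩ := hf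
  rw [← Real.sqrt_le_left (hardyNorm_nonneg f)]
  refine le_ciSup (f := fun r : Ico (0 : ℝ) 1 =>
    √(Real.circleAverage (fun z => ‖f z‖ ^ 2) 0 (r : ℝ))) ⟨√C, ?_⟩ ⟨r, h0, h1⟩
  rintro _ ⟨t, rfl⟩
  exact Real.sqrt_le_sqrt (hC t t.2.1 t.2.2)

/-- Monotone means turn the supremum in the norm into a limit, the form in which orthogonality is
stated. -/
lemma tendsto_circleAverage_hardyNorm {f : ℂ → ℂ} (hf : f ∈ hardyTwo) :
    Tendsto (fun r : ℝ => Real.circleAverage (fun z => ‖f z‖ ^ 2) 0 r) (𝓝[<] 1)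
      (𝓝 (hardyNorm f ^ 2)) := by
  rw [tendsto_order]
  refine ⟨fun a ha => ?_, fun a ha => ?_⟩
  · obtain ⟨⟨t, ht⟩, hlt⟩ : ∃ t : Ico (0 : ℝ) 1,
        a < Real.circleAverage (fun z => ‖f z‖ ^ 2) 0 (t : ℝ) := by
      by_contra! h
      have : Nonempty (Ico (0 : ℝ) 1) := ⟨⟨0, by simp⟩⟩
      have ha0 : 0 ≤ a := (circleAverage_sq_nonneg f 0).trans (h ⟨0, by simp⟩)
      have : hardyNorm f ≤ √a := ciSup_le fun t => Real.sqrt_le_sqrt (h t)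
      have := (Real.le_sqrt (hardyNorm_nonneg f) ha0).1 this
      linarith
    filter_upwards [eventually_mem_Ioo ht.2] with r hr
    exact hlt.trans_le (circleAverage_sq_mono hf.1 ht.1 hr.1.le hr.2)
  · filter_upwards [eventually_mem_Ioo zero_lt_one] with r hr
    exact (circleAverage_sq_le_hardyNorm hf hr.1.le hr.2).trans_lt ha

lemma norm_le_supNorm {f : ℂ → ℂ} (hf : f ∈ hardyInfty) {z : ℂ} (hz : z ∈ disk) :
    ‖f z‖ ≤ supNorm f := by
  obtain ⟨-, C, hC⟩ := hf
  refine le_ciSup (f := fun z : disk => ‖f z‖) ⟨C, ?_⟩ ⟨z, hz⟩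
  rintro _ ⟨w, rfl⟩
  exact hC w w.2

lemma supNorm_nonneg (f : ℂ → ℂ) : 0 ≤ supNorm f :=
  Real.iSup_nonneg fun _ => norm_nonneg _

lemma supNorm_le {f : ℂ → ℂ} {C : ℝ} (h : ∀ z ∈ disk, ‖f z‖ ≤ C) : supNorm f ≤ C := by
  have : Nonempty disk := ⟨⟨0, by simp [disk]⟩⟩
  exact ciSup_le fun z => h z z.2

lemma hardyInfty_subset_hardyTwo : hardyInfty ⊆ hardyTwo := by
  rintro f ⟨hd, C, hC⟩
  refine ⟨hd, C ^ 2, fun r h0 h1 => Real.circleAverage_mono_on_of_le_circle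
    (circleIntegrable_of_continuousOn_disk (hd.continuousOn.norm.pow 2) h0 h1) fun z hz => ?_⟩
  gcongr
  exact hC z (sphere_subset_disk h0 h1 hz)

lemma eq_zero_of_hardyNorm_eq_zero {f : ℂ → ℂ} (hf : f ∈ hardyTwo) (h : hardyNorm f = 0) {z : ℂ}
    (hz : z ∈ disk) : f z = 0 := by
  have hz1 : ‖z‖ < 1 := by simpa [disk] using hz
  obtain ⟨r, hr, hr1⟩ := exists_between hz1
  have h0 : 0 ≤ r := (norm_nonneg z).trans hr.le
  have h2 := norm_pow_le_circleAverage hf.1 hr hr1 2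
  have h3 := circleAverage_sq_le_hardyNorm hf h0 hr1
  rw [h, zero_pow two_ne_zero] at h3
  rw [le_antisymm h3 (circleAverage_sq_nonneg f r), mul_zero] at h2
  simpa using le_antisymm h2 (by positivity)

/-! ### The norm inequality. -/

lemma hardyNorm_sq_le {Θ φ : ℂ → ℂ} (hΘ : IsInner Θ) (hφ : φ ∈ modelSpace Θ)
    (hb : φ ∈ hardyInfty) : hardyNorm φ ^ 2 ≤ (1 - ‖Θ 0‖) * supNorm φ ^ 2 := by
  set M := supNorm φ
  have horth := hφ.2 φ hφ.1
  have hlim := tendsto_circleAverage_hardyNorm hφ.1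
  have hcφ := hφ.1.1.continuousOn
  have hcΘ : ContinuousOn Θ disk := hΘ.1.1.continuousOn
  have hcΘ' : ContinuousOn (fun z => conj (Θ z)) disk := Complex.continuous_conj.comp_continuousOn hcΘ
  -- The left side is the modulus of the mean of `(M² - |φ|²) conj Θ` on the circle of radius `r`.
  -- Its subtracted term vanishes in the limit by orthogonality of `φ` to `Θ φ`.
  have hineq : ∀ᶠ r : ℝ in 𝓝[<] 1,
      ‖(M : ℂ) ^ 2 * conj (Θ 0) - Real.circleAverage (fun z => φ z * conj (Θ z * φ z)) 0 r‖ ≤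
        M ^ 2 - Real.circleAverage (fun z => ‖φ z‖ ^ 2) 0 r := by
    filter_upwards [eventually_mem_Ioo zero_lt_one] with r ⟨h0, h1⟩
    have hmean : Real.circleAverage (fun z => conj (Θ z)) 0 r = conj (Θ 0) := by
      have := ContinuousLinearMap.circleAverage_comp_comm (Complex.conjCLE : ℂ →L[ℝ] ℂ)
        (circleIntegrable_of_continuousOn_disk hcΘ h0.le h1)
      rw [DiffContOnCl.circleAverage (f := Θ)
        (by rw [abs_of_pos h0]; exact diffContOnCl_ball hΘ.1.1 h1)] at this
      exact this
    have hcong : Real.circleAverage (fun z => ((M : ℂ) ^ 2 - (‖φ z‖ : ℂ) ^ 2) * conj (Θ z)) 0 r =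
        (M : ℂ) ^ 2 * conj (Θ 0) - Real.circleAverage (fun z => φ z * conj (Θ z * φ z)) 0 r := by
      rw [← hmean, ← smul_eq_mul, ← Real.circleAverage_fun_smul, ← Real.circleAverage_fun_sub]
      · congr 1
        ext z
        rw [← Complex.mul_conj', map_mul, smul_eq_mul]
        ring
      · exact circleIntegrable_of_continuousOn_disk (hcΘ'.fun_const_smul _) h0.le h1
      · refine circleIntegrable_of_continuousOn_disk (hcφ.mul ?_) h0.le h1
        exact Complex.continuous_conj.comp_continuousOn (hcΘ.mul hcφ)
    have hsub : M ^ 2 - Real.circleAverage (fun z => ‖φ z‖ ^ 2) 0 r =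
        Real.circleAverage (fun z => M ^ 2 - ‖φ z‖ ^ 2) 0 r := by
      rw [Real.circleAverage_fun_sub (f₂ := fun z => ‖φ z‖ ^ 2) (circleIntegrable_const _ _ _)
        (circleIntegrable_of_continuousOn_disk (hcφ.norm.pow 2) h0.le h1),
        Real.circleAverage_const]
    rw [← hcong, hsub]
    refine (norm_circleAverage_le _ _ _).trans (Real.circleAverage_mono ?_ ?_ fun z hz => ?_)
    · refine circleIntegrable_of_continuousOn_disk (ContinuousOn.norm (ContinuousOn.mul ?_ hcΘ'))
        h0.le h1
      exact continuousOn_const.sub ((Complex.continuous_ofReal.comp_continuousOn hcφ.norm).pow 2)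
    · exact circleIntegrable_of_continuousOn_disk (continuousOn_const.sub (hcφ.norm.pow 2)) h0.le h1
    · have hz' := sphere_subset_disk h0.le h1 hz
      have h2 : 0 ≤ M ^ 2 - ‖φ z‖ ^ 2 := by
        have := norm_le_supNorm hb hz'
        have := pow_le_pow_left₀ (norm_nonneg _) this 2
        linarith
      rw [norm_mul, RCLike.norm_conj]
      have h3 : ‖(M : ℂ) ^ 2 - (‖φ z‖ : ℂ) ^ 2‖ = M ^ 2 - ‖φ z‖ ^ 2 := by
        rw [← Complex.ofReal_pow, ← Complex.ofReal_pow, ← Complex.ofReal_sub, Complex.norm_real,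
          Real.norm_of_nonneg h2]
      rw [h3]
      exact mul_le_of_le_one_right h2 (hΘ.norm_le_one hz')
  have h := le_of_tendsto_of_tendsto ((tendsto_const_nhds.sub horth).norm)
    (tendsto_const_nhds.sub hlim) hineq
  rw [sub_zero, norm_mul, RCLike.norm_conj, norm_pow, Complex.norm_real, Real.norm_eq_abs,
    sq_abs] at h
  linarith

/-! ### Model spaces of finite Blaschke products consist of rational functions. -/

lemma circleAverage_div_pow {g : ℂ → ℂ} (hg : DifferentiableOn ℂ g disk) {r : ℝ} (h0 : 0 < r)
    (h1 : r < 1) (m : ℕ) :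
    Real.circleAverage (fun z => g z / z ^ m) 0 r = iteratedDeriv m g 0 / m.factorial := by
  have h := DiffContOnCl.circleIntegral_one_div_sub_center_pow_smul h0 m (diffContOnCl_ball hg h1)
  rw [Real.circleAverage_eq_circleIntegral h0.ne']
  have h2 : (∮ z in C(0, r), (z - 0)⁻¹ • (g z / z ^ m)) =
      ∮ z in C(0, r), (1 / (z - 0) ^ (m + 1)) • g z := by
    congr 1
    ext z
    simp only [sub_zero, smul_eq_mul, pow_succ]
    rw [div_eq_mul_inv, div_eq_mul_inv, one_mul, mul_inv]
    ring
  rw [h2, h, smul_eq_mul, smul_eq_mul]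
  have := two_pi_I_ne_zero
  field_simp

lemma eq_sum_range_of_iteratedDeriv_eq_zero {g : ℂ → ℂ} (hg : DifferentiableOn ℂ g disk) {n : ℕ}
    (h : ∀ m, n ≤ m → iteratedDeriv m g 0 = 0) {z : ℂ} (hz : z ∈ disk) :
    g z = ∑ m ∈ Finset.range n, (m.factorial : ℂ)⁻¹ * z ^ m * iteratedDeriv m g 0 := by
  have h1 := hasSum_taylorSeries_on_ball hg hz
  have h2 : HasSum (fun m : ℕ => (m.factorial : ℂ)⁻¹ • (z - 0) ^ m • iteratedDeriv m g 0)
      (∑ m ∈ Finset.range n, (m.factorial : ℂ)⁻¹ • (z - 0) ^ m • iteratedDeriv m g 0) := by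
    refine hasSum_sum_of_ne_finset_zero fun m hm => ?_
    rw [h m (by simpa using hm), smul_zero, smul_zero]
  rw [h1.unique h2]
  simp [mul_assoc]

lemma mem_hardyInfty_of_differentiable {h : ℂ → ℂ} (hh : Differentiable ℂ h) : h ∈ hardyInfty := by
  obtain ⟨C, hC⟩ := (isCompact_closedBall (0 : ℂ) 1).exists_bound_of_continuousOn
    hh.continuous.continuousOn
  exact ⟨hh.differentiableOn, C, fun z hz => hC z (Metric.ball_subset_closedBall hz)⟩

lemma one_sub_conj_mul_ne_zero {a z : ℂ} (ha : a ∈ disk) (hz : z ∈ Metric.closedBall (0 : ℂ) 1) :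
    1 - conj a * z ≠ 0 := by
  rw [disk, mem_ball_zero_iff] at ha
  rw [mem_closedBall_zero_iff] at hz
  intro h
  have h1 : ‖conj a * z‖ = 1 := by rw [← sub_eq_zero.1 h, norm_one]
  rw [norm_mul, RCLike.norm_conj] at h1
  nlinarith [norm_nonneg a, norm_nonneg z]

/-- On the unit circle `conj z = z⁻¹`, so each factor is `1 - conj a * z = z * conj (z - a)`. This
turns orthogonality into a statement about Taylor coefficients. -/
lemma prod_one_sub_conj_mul_of_norm_eq_one {n : ℕ} (a : Fin n → ℂ) {z : ℂ} (hz : ‖z‖ = 1) (k : ℕ) :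
    (∏ i, (1 - conj (a i) * z)) / z ^ (n + k) = conj ((∏ i, (z - a i)) * z ^ k) := by
  have hz0 : z ≠ 0 := by rintro rfl; simp at hz
  have hzz : conj z = z⁻¹ := by rw [inv_def, normSq_eq_norm_sq, hz]; simp
  have hp : ∏ i, (1 - conj (a i) * z) = z ^ n * ∏ i, conj (z - a i) := by
    have : z ^ n = ∏ _i : Fin n, z := by simp
    rw [this, ← Finset.prod_mul_distrib]
    refine Finset.prod_congr rfl fun i _ => ?_
    rw [map_sub, hzz]
    field_simp
  rw [hp, map_mul, map_prod, map_pow, hzz, pow_add, mul_div_mul_left _ _ (pow_ne_zero n hz0),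
    inv_pow, div_eq_mul_inv]

/-- The Taylor coefficients of `φ ∏ (1 - conj aᵢ z)` vanish from the degree of the Blaschke
product on, as `φ` is orthogonal to `∏ (z - aᵢ) z ^ k` for all `k`. -/
lemma iteratedDeriv_mul_prod_eq_zero {Θ φ : ℂ → ℂ} {n : ℕ} {a : Fin n → ℂ} {c : ℂ}
    (ha : ∀ i, a i ∈ disk) (hc : ‖c‖ = 1)
    (hΘ : ∀ z ∈ disk, Θ z = c * ∏ i, (z - a i) / (1 - conj (a i) * z))
    (hφ : φ ∈ modelSpace Θ) (hb : φ ∈ hardyInfty) {m : ℕ} (hm : n ≤ m) :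
    iteratedDeriv m (fun z => φ z * ∏ i, (1 - conj (a i) * z)) 0 = 0 := by
  obtain ⟨k, rfl⟩ := Nat.exists_eq_add_of_le hm
  set P : ℂ → ℂ := fun z => ∏ i, (z - a i)
  set Q : ℂ → ℂ := fun z => ∏ i, (1 - conj (a i) * z)
  have hQd : Differentiable ℂ Q := by fun_prop
  have hPc : Continuous P := by fun_prop
  have hφc := hφ.1.1.continuousOn
  have hgd : DifferentiableOn ℂ (fun z => φ z * Q z) disk := hφ.1.1.mul hQd.differentiableOn
  have horth : Tendsto (fun r : ℝ => Real.circleAverage (fun z => φ z * conj (c * (P z * z ^ k))) 0 r)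
      (𝓝[<] 1) (𝓝 0) := by
    -- The factor `Q` in the test function cancels the denominator of `Θ`.
    have h1 := hφ.2 (fun z => Q z * z ^ k) (hardyInfty_subset_hardyTwo
      (mem_hardyInfty_of_differentiable (by fun_prop)))
    refine h1.congr' ?_
    filter_upwards [eventually_mem_Ioo zero_lt_one] with r hr
    refine Real.circleAverage_congr_sphere fun z hz => ?_
    have hz' := sphere_subset_disk hr.1.le hr.2 hz
    have hQ : Q z ≠ 0 := Finset.prod_ne_zero_iff.2 fun i _ =>
      one_sub_conj_mul_ne_zero (ha i) (Metric.ball_subset_closedBall hz')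
    have h2 : Θ z * (Q z * z ^ k) = c * (P z * z ^ k) := by
      rw [hΘ z hz', Finset.prod_div_distrib]
      change c * (P z / Q z) * _ = _
      field_simp
    simp only [h2]
  -- `D` is the error in using the unit-circle identity at radius `r < 1`. It vanishes on the unit
  -- circle, so its contribution disappears as `r → 1`.
  set D : ℂ → ℂ := fun z => conj c * (Q z / z ^ (n + k)) - conj (c * (P z * z ^ k))
  have hDc : ContinuousOn D {0}ᶜ := by
    refine ContinuousOn.sub (continuousOn_const.mul (hQd.continuous.continuousOn.div
      (by fun_prop) fun z hz => pow_ne_zero _ hz)) ?_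
    exact (Complex.continuous_conj.comp (by fun_prop)).continuousOn
  have hD1 : ∀ z : ℂ, ‖z‖ = 1 → D z = 0 := by
    intro z hz
    simp only [D, P, Q]
    rw [prod_one_sub_conj_mul_of_norm_eq_one a hz, ← map_mul, sub_self]
  have hφD : Tendsto (fun r : ℝ => Real.circleAverage (fun z => φ z * D z) 0 r) (𝓝[<] 1)
      (𝓝 0) := by
    obtain ⟨C, hC⟩ := hb.2
    -- `D` may blow up at the origin, so it is bounded only on the annulus `1/2 ≤ |z| ≤ 1`.
    obtain ⟨B, hB⟩ := ((isCompact_closedBall (0 : ℂ) 1).diff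
      (Metric.isOpen_ball (x := (0 : ℂ)) (ε := 1 / 2))).exists_bound_of_continuousOn
      (hDc.mono fun z hz h => hz.2 (by simp [mem_singleton_iff.1 h]))
    have hmem : ∀ r ∈ Ioo (1 / 2 : ℝ) 1, ∀ z ∈ Metric.sphere (0 : ℂ) |r|,
        z ∈ disk ∧ z ∈ Metric.closedBall (0 : ℂ) 1 \ Metric.ball 0 (1 / 2) ∧ z ≠ 0 := by
      intro r hr z hz
      have h0 : 0 < r := by linarith [hr.1]
      refine ⟨sphere_subset_disk h0.le hr.2 hz, ?_⟩
      rw [abs_of_pos h0, mem_sphere_zero_iff_norm] at hz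
      refine ⟨⟨?_, ?_⟩, norm_pos_iff.1 (hz ▸ h0)⟩
      · rw [mem_closedBall_zero_iff, hz]; exact hr.2.le
      · rw [mem_ball_zero_iff, hz]; exact not_lt.2 hr.1.le
    have := tendsto_circleAverage_of_bounded (l := 𝓝[<] (1 : ℝ)) (F := fun _ z => φ z * D z)
      (ρ := id) (L := fun _ => (0 : ℂ)) (C * B) ?_ ?_ ?_
    · simpa using this
    · filter_upwards [eventually_mem_Ioo (a := 1 / 2) (by norm_num)] with r hr
      exact (hφc.mono fun z hz => (hmem r hr z hz).1).mul (hDc.mono fun z hz => (hmem r hr z hz).2.2)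
    · filter_upwards [eventually_mem_Ioo (a := 1 / 2) (by norm_num)] with r hr z hz
      rw [norm_mul]
      obtain ⟨h1, h2, -⟩ := hmem r hr z hz
      exact mul_le_mul (hC z h1) (hB z h2) (norm_nonneg _) ((norm_nonneg _).trans (hC z h1))
    · refine ae_of_all _ fun θ => ?_
      have hcirc : Tendsto (fun r : ℝ => circleMap 0 r θ) (𝓝[<] 1) (𝓝 (circleMap 0 1 θ)) :=
        ((by fun_prop [circleMap] : Continuous fun r : ℝ => circleMap 0 r θ).tendsto 1).mono_left
          nhdsWithin_le_nhds
      have hn : ‖circleMap 0 1 θ‖ = 1 := by simp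
      have hDt : Tendsto (fun r : ℝ => D (circleMap 0 r θ)) (𝓝[<] 1) (𝓝 0) := by
        have hne : circleMap 0 1 θ ≠ 0 := norm_ne_zero_iff.1 (by rw [hn]; exact one_ne_zero)
        have := (hDc.continuousAt (isOpen_compl_singleton.mem_nhds hne)).tendsto.comp hcirc
        rwa [hD1 _ hn] at this
      have hz : Tendsto (fun r : ℝ => C * ‖D (circleMap 0 r θ)‖) (𝓝[<] 1) (𝓝 0) := by
        simpa using hDt.norm.const_mul C
      refine squeeze_zero_norm' ?_ hz
      filter_upwards [eventually_mem_Ioo zero_lt_one] with r hr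
      rw [norm_mul]
      exact mul_le_mul_of_nonneg_right (hC _ (circleMap_mem_disk hr.1.le hr.2 θ)) (norm_nonneg _)
  have hlim : Tendsto (fun r : ℝ => conj c * Real.circleAverage (fun z => φ z * Q z / z ^ (n + k)) 0 r)
      (𝓝[<] 1) (𝓝 (0 + 0)) := by
    refine (horth.add hφD).congr' ?_
    filter_upwards [eventually_mem_Ioo zero_lt_one] with r hr
    have hs := sphere_subset_disk hr.1.le hr.2
    have hs0 : Metric.sphere (0 : ℂ) |r| ⊆ {0}ᶜ := by
      intro z hz h
      rw [mem_singleton_iff.1 h, abs_of_pos hr.1, mem_sphere_zero_iff_norm, norm_zero] at hz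
      exact hr.1.ne hz
    rw [← smul_eq_mul (conj c), ← Real.circleAverage_fun_smul, ← Real.circleAverage_fun_add]
    · congr 1
      ext z
      simp only [D, smul_eq_mul]
      ring
    · refine ContinuousOn.circleIntegrable' ((hφc.mono hs).mul ?_)
      exact (Complex.continuous_conj.comp (by fun_prop)).continuousOn
    · exact ContinuousOn.circleIntegrable' ((hφc.mono hs).mul (hDc.mono hs0))
  -- The average is a Taylor coefficient, hence independent of `r`, so its limit 0 is its value.
  have hconst : Tendsto (fun r : ℝ => conj c *
      Real.circleAverage (fun z => φ z * Q z / z ^ (n + k)) 0 r) (𝓝[<] 1)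
      (𝓝 (conj c * (iteratedDeriv (n + k) (fun z => φ z * Q z) 0 / (n + k).factorial))) := by
    refine tendsto_const_nhds.congr' ?_
    filter_upwards [eventually_mem_Ioo zero_lt_one] with r hr
    rw [circleAverage_div_pow hgd hr.1 hr.2]
  have h := tendsto_nhds_unique hconst hlim
  have hc0 : conj c ≠ 0 := by
    rw [← norm_ne_zero_iff, RCLike.norm_conj, hc]
    exact one_ne_zero
  rw [add_zero, mul_eq_zero, div_eq_zero_iff, Nat.cast_eq_zero] at h
  exact (h.resolve_left hc0).resolve_right (Nat.factorial_ne_zero _)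

/-- The vanishing coefficients make `φ ∏ (1 - conj aᵢ z)` a polynomial of degree below `n`, and the
product has no zero on the closed disk. -/
lemma exists_continuousOn_closedBall {Θ φ : ℂ → ℂ} (hΘ : IsFiniteBlaschkeProduct Θ)
    (hφ : φ ∈ modelSpace Θ) (hb : φ ∈ hardyInfty) :
    ∃ F : ℂ → ℂ, ContinuousOn F (Metric.closedBall 0 1) ∧ ∀ z ∈ disk, φ z = F z := by
  obtain ⟨n, a, c, ha, hc, hΘ⟩ := hΘ
  have hQ : ∀ z ∈ Metric.closedBall (0 : ℂ) 1, ∏ i, (1 - conj (a i) * z) ≠ 0 := fun z hz =>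
    Finset.prod_ne_zero_iff.2 fun i _ => one_sub_conj_mul_ne_zero (ha i) hz
  set g : ℂ → ℂ := fun z => φ z * ∏ i, (1 - conj (a i) * z)
  have hgd : DifferentiableOn ℂ g disk :=
    hφ.1.1.mul (by fun_prop : Differentiable ℂ _).differentiableOn
  refine ⟨fun z => (∑ m ∈ Finset.range n, (m.factorial : ℂ)⁻¹ * z ^ m * iteratedDeriv m g 0) /
    ∏ i, (1 - conj (a i) * z), ContinuousOn.div (by fun_prop) (by fun_prop) hQ, fun z hz => ?_⟩
  rw [eq_div_iff (hQ z (Metric.ball_subset_closedBall hz))]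
  exact eq_sum_range_of_iteratedDeriv_eq_zero hgd
    (fun m hm => iteratedDeriv_mul_prod_eq_zero ha hc hΘ hφ hb hm) hz

/-! ### Constant modulus on the boundary. -/

lemma tendsto_of_continuousOn_closedBall {F φ : ℂ → ℂ}
    (hF : ContinuousOn F (Metric.closedBall 0 1)) (h : ∀ z ∈ disk, φ z = F z) (θ : ℝ) :
    Tendsto (fun r : ℝ => φ (circleMap 0 r θ)) (𝓝[<] 1) (𝓝 (F (circleMap 0 1 θ))) := by
  have hcirc : Tendsto (fun r : ℝ => circleMap 0 r θ) (𝓝[<] 1) (𝓝 (circleMap 0 1 θ)) :=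
    ((by fun_prop [circleMap] : Continuous fun r : ℝ => circleMap 0 r θ).tendsto 1).mono_left
      nhdsWithin_le_nhds
  have hmem : circleMap 0 1 θ ∈ Metric.closedBall (0 : ℂ) 1 := by simp
  have h1 : Tendsto (fun r : ℝ => F (circleMap 0 r θ)) (𝓝[<] 1) (𝓝 (F (circleMap 0 1 θ))) := by
    refine (hF _ hmem).tendsto.comp (tendsto_nhdsWithin_iff.2 ⟨hcirc, ?_⟩)
    filter_upwards [eventually_mem_Ioo zero_lt_one] with r hr
    exact Metric.ball_subset_closedBall (circleMap_mem_disk hr.1.le hr.2 θ)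
  refine h1.congr' ?_
  filter_upwards [eventually_mem_Ioo zero_lt_one] with r hr
  exact (h _ (circleMap_mem_disk hr.1.le hr.2 θ)).symm

/-- A bounded analytic function that is continuous up to the boundary and whose `H²` norm equals
its supremum norm has constant modulus on the unit circle. -/
lemma norm_eq_of_hardyNorm_eq_supNorm {F φ : ℂ → ℂ}
    (hF : ContinuousOn F (Metric.closedBall 0 1)) (h : ∀ z ∈ disk, φ z = F z)
    (hφ : φ ∈ hardyInfty) (heq : hardyNorm φ = supNorm φ) (θ : ℝ) :
    ‖F (circleMap 0 1 θ)‖ = supNorm φ := by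
  set M := supNorm φ
  have hle : ∀ t, ‖F (circleMap 0 1 t)‖ ≤ M := by
    intro t
    refine le_of_tendsto (tendsto_of_continuousOn_closedBall hF h t).norm ?_
    filter_upwards [eventually_mem_Ioo zero_lt_one] with r hr
    exact norm_le_supNorm hφ (circleMap_mem_disk hr.1.le hr.2 t)
  have hcont : Continuous fun t => F (circleMap 0 1 t) :=
    hF.comp_continuous (continuous_circleMap 0 1) fun t => by simp
  have hint : Tendsto (fun r : ℝ => Real.circleAverage (fun z => ‖φ z‖ ^ 2) 0 r) (𝓝[<] 1)
      (𝓝 ((2 * Real.pi)⁻¹ • ∫ t in 0..2 * Real.pi, ‖F (circleMap 0 1 t)‖ ^ 2)) := by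
    refine tendsto_circleAverage_of_bounded (ρ := id) (M ^ 2) ?_ ?_ (ae_of_all _ fun t =>
      (tendsto_of_continuousOn_closedBall hF h t).norm.pow 2)
    · filter_upwards [eventually_mem_Ioo zero_lt_one] with r hr
      exact (hφ.1.continuousOn.mono (sphere_subset_disk hr.1.le hr.2)).norm.pow 2
    · filter_upwards [eventually_mem_Ioo zero_lt_one] with r hr z hz
      rw [norm_pow, norm_norm]
      gcongr
      exact norm_le_supNorm hφ (sphere_subset_disk hr.1.le hr.2 hz)
  have h1 := tendsto_nhds_unique hint
    (tendsto_circleAverage_hardyNorm (hardyInfty_subset_hardyTwo hφ))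
  have hper : Function.Periodic (fun t => M ^ 2 - ‖F (circleMap 0 1 t)‖ ^ 2) (2 * Real.pi) :=
    fun t => by simp only [periodic_circleMap 0 1 t]
  -- By periodicity the period may start at `θ`, which places the given point in the interval of
  -- integration for the positivity argument.
  have hzero : ∫ t in θ..θ + 2 * Real.pi, (M ^ 2 - ‖F (circleMap 0 1 t)‖ ^ 2) = 0 := by
    rw [hper.intervalIntegral_add_eq θ 0, zero_add, intervalIntegral.integral_sub
      (g := fun t => ‖F (circleMap 0 1 t)‖ ^ 2)
      intervalIntegrable_const ((hcont.norm.pow 2).intervalIntegrable _ _),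
      intervalIntegral.integral_const, sub_zero]
    rw [heq, smul_eq_mul, inv_mul_eq_iff_eq_mul₀ Real.two_pi_pos.ne'] at h1
    rw [h1, smul_eq_mul, sub_self]
  refine (hle θ).antisymm ?_
  by_contra! hlt
  have hpos : 0 < ∫ t in θ..θ + 2 * Real.pi, (M ^ 2 - ‖F (circleMap 0 1 t)‖ ^ 2) := by
    refine intervalIntegral.integral_pos (by linarith [Real.two_pi_pos])
      (continuous_const.sub (hcont.norm.pow 2)).continuousOn (fun t _ => ?_)
      ⟨θ, ⟨le_rfl, by linarith [Real.two_pi_pos]⟩, ?_⟩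
    · exact sub_nonneg.2 (pow_le_pow_left₀ (norm_nonneg _) (hle t) 2)
    · exact sub_pos.2 (pow_lt_pow_left₀ hlt (norm_nonneg _) two_ne_zero)
  exact hpos.ne' hzero

/-! ### Scalar multiples and the extremal functions. -/

lemma circleAverage_sq_const_mul (c : ℂ) (f : ℂ → ℂ) (r : ℝ) :
    Real.circleAverage (fun z => ‖c * f z‖ ^ 2) 0 r =
      ‖c‖ ^ 2 * Real.circleAverage (fun z => ‖f z‖ ^ 2) 0 r := by
  rw [← smul_eq_mul, ← Real.circleAverage_fun_smul]
  simp only [norm_mul, mul_pow, smul_eq_mul]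

lemma const_mul_mem_modelSpace {Θ f : ℂ → ℂ} (c : ℂ) (hf : f ∈ modelSpace Θ) :
    (fun z => c * f z) ∈ modelSpace Θ := by
  obtain ⟨⟨hd, C, hC⟩, horth⟩ := hf
  refine ⟨⟨hd.const_mul c, ‖c‖ ^ 2 * C, fun r h0 h1 => ?_⟩, fun h hh => ?_⟩
  · rw [circleAverage_sq_const_mul]
    gcongr
    exact hC r h0 h1
  · have h1 := (horth h hh).const_mul c
    rw [mul_zero] at h1
    refine h1.congr fun r => ?_
    rw [← smul_eq_mul, ← Real.circleAverage_fun_smul]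
    simp only [smul_eq_mul, mul_assoc]

lemma IsInner.hardyNorm_eq_one {u : ℂ → ℂ} (hu : IsInner u) : hardyNorm u = 1 := by
  have h := tendsto_nhds_unique (hu.tendsto_circleAverage 2)
    (tendsto_circleAverage_hardyNorm (hardyInfty_subset_hardyTwo hu.1))
  exact (sq_eq_sq₀ (hardyNorm_nonneg u) zero_le_one).1 (by rw [← h, one_pow])

lemma hardyNorm_const_mul_of_eqOn {φ u : ℂ → ℂ} {c : ℂ} (hu : u ∈ hardyTwo) (hφ : φ ∈ hardyTwo)
    (h : ∀ z ∈ disk, φ z = c * u z) : hardyNorm φ = ‖c‖ * hardyNorm u := by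
  refine (sq_eq_sq₀ (hardyNorm_nonneg φ) (mul_nonneg (norm_nonneg c) (hardyNorm_nonneg u))).1 ?_
  rw [mul_pow]
  refine tendsto_nhds_unique (tendsto_circleAverage_hardyNorm hφ)
    (((tendsto_circleAverage_hardyNorm hu).const_mul (‖c‖ ^ 2)).congr' ?_)
  filter_upwards [eventually_mem_Ioo zero_lt_one] with r hr
  rw [← circleAverage_sq_const_mul]
  refine Real.circleAverage_congr_sphere fun z hz => ?_
  simp only [h z (sphere_subset_disk hr.1.le hr.2 hz)]

lemma hardyNorm_le_supNorm {f : ℂ → ℂ} (hf : f ∈ hardyInfty) : hardyNorm f ≤ supNorm f := by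
  refine (sq_le_sq₀ (hardyNorm_nonneg f) (supNorm_nonneg f)).1 (le_of_tendsto
    (tendsto_circleAverage_hardyNorm (hardyInfty_subset_hardyTwo hf)) ?_)
  filter_upwards [eventually_mem_Ioo zero_lt_one] with r hr
  refine Real.circleAverage_mono_on_of_le_circle
    (circleIntegrable_of_continuousOn_disk (hf.1.continuousOn.norm.pow 2) hr.1.le hr.2) fun z hz => ?_
  gcongr
  exact norm_le_supNorm hf (sphere_subset_disk hr.1.le hr.2 hz)

lemma exists_inner_of_hardyNorm_eq_supNorm {Θ φ : ℂ → ℂ} (hΘ : IsFiniteBlaschkeProduct Θ)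
    (hφ : φ ∈ modelSpace Θ) (hb : φ ∈ hardyInfty) (heq : hardyNorm φ = supNorm φ)
    (hM : supNorm φ ≠ 0) :
    ∃ (c : ℂ) (u : ℂ → ℂ), IsInner u ∧ u ∈ modelSpace Θ ∧ ∀ z ∈ disk, φ z = c * u z := by
  obtain ⟨F, hF, hFφ⟩ := exists_continuousOn_closedBall hΘ hφ hb
  have hM' : (supNorm φ : ℂ) ≠ 0 := Complex.ofReal_ne_zero.2 hM
  refine ⟨supNorm φ, fun z => (supNorm φ : ℂ)⁻¹ * φ z, ⟨⟨hb.1.const_mul _, 1, fun z hz => ?_⟩,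
    ae_of_all _ fun θ => ⟨(supNorm φ : ℂ)⁻¹ * F (circleMap 0 1 θ), ?_,
      (tendsto_of_continuousOn_closedBall hF hFφ θ).const_mul _⟩⟩,
    const_mul_mem_modelSpace _ hφ, fun z _ => ?_⟩
  · rw [norm_mul, norm_inv, Complex.norm_real, Real.norm_of_nonneg (supNorm_nonneg φ)]
    exact inv_mul_le_one_of_le₀ (norm_le_supNorm hb hz) (supNorm_nonneg φ)
  · rw [norm_mul, norm_inv, Complex.norm_real, Real.norm_of_nonneg (supNorm_nonneg φ),
      norm_eq_of_hardyNorm_eq_supNorm hF hFφ hb heq, inv_mul_cancel₀ hM]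
  · rw [mul_inv_cancel_left₀ hM']

end ModelSpace

theorem corollary3p3 (Θ : ℂ → ℂ) (hΘ : ModelSpace.IsInner Θ) :
    (∀ φ : ℂ → ℂ, φ ∈ ModelSpace.modelSpace Θ → φ ∈ ModelSpace.hardyInfty →
      ModelSpace.hardyNorm φ ≤ √(1 - ‖Θ 0‖ ^ 2) * ModelSpace.supNorm φ) ∧
    (ModelSpace.IsFiniteBlaschkeProduct Θ →
      ∀ φ : ℂ → ℂ, φ ∈ ModelSpace.modelSpace Θ → φ ∈ ModelSpace.hardyInfty →
        (ModelSpace.hardyNorm φ = √(1 - ‖Θ 0‖ ^ 2) * ModelSpace.supNorm φ ↔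
          (∀ z ∈ ModelSpace.disk, φ z = 0) ∨
          ∃ (c : ℂ) (u : ℂ → ℂ), ModelSpace.IsInner u ∧ u ∈ ModelSpace.modelSpace Θ ∧
            ∀ z ∈ ModelSpace.disk, φ z = c * u z)) := by
  have ht0 := norm_nonneg (Θ 0)
  have ht1 : ‖Θ 0‖ ≤ 1 := hΘ.norm_le_one (by simp [ModelSpace.disk])
  have hnn : 0 ≤ 1 - ‖Θ 0‖ ^ 2 := by nlinarith
  refine ⟨fun φ hφ hb => ?_, fun hB φ hφ hb => ⟨fun heq => ?_, ?_⟩⟩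
  · refine (sq_le_sq₀ (ModelSpace.hardyNorm_nonneg φ)
      (mul_nonneg (Real.sqrt_nonneg _) (ModelSpace.supNorm_nonneg φ))).1 ?_
    rw [mul_pow, Real.sq_sqrt hnn]
    refine (ModelSpace.hardyNorm_sq_le hΘ hφ hb).trans ?_
    gcongr
    nlinarith
  · have hle := ModelSpace.hardyNorm_sq_le hΘ hφ hb
    by_cases hM : ModelSpace.supNorm φ = 0
    · left
      exact fun z hz => norm_le_zero_iff.1 (hM ▸ ModelSpace.norm_le_supNorm hb hz)
    have hM2 : 0 < ModelSpace.supNorm φ ^ 2 := by positivity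
    rw [heq, mul_pow, Real.sq_sqrt hnn] at hle
    have hle' := le_of_mul_le_mul_right hle hM2
    -- `hle'` reads `1 - t² ≤ 1 - t` with `t = ‖Θ 0‖` in `[0, 1]`, so `t` is 0 or 1.
    rcases ht0.eq_or_lt with h | h
    · right
      refine ModelSpace.exists_inner_of_hardyNorm_eq_supNorm hB hφ hb ?_ hM
      rw [heq, ← h]
      simp
    · left
      have h1 : ‖Θ 0‖ = 1 := by nlinarith
      rw [h1] at heq
      exact fun z hz => ModelSpace.eq_zero_of_hardyNorm_eq_zero hφ.1 (by simpa using heq) hz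
  · rintro (h | ⟨c, u, hu, huΘ, h⟩)
    · have h1 : ModelSpace.supNorm φ = 0 :=
        (ModelSpace.supNorm_le fun z hz => by rw [h z hz, norm_zero]).antisymm
          (ModelSpace.supNorm_nonneg φ)
      have h2 := ModelSpace.hardyNorm_le_supNorm hb
      rw [h1] at h2 ⊢
      rw [mul_zero]
      exact h2.antisymm (ModelSpace.hardyNorm_nonneg φ)
    · have hn := ModelSpace.hardyNorm_const_mul_of_eqOn huΘ.1 hφ.1 h
      rw [hu.hardyNorm_eq_one, mul_one] at hn
      have hs : ModelSpace.supNorm φ = ‖c‖ := by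
        refine le_antisymm (ModelSpace.supNorm_le fun z hz => ?_)
          (hn ▸ ModelSpace.hardyNorm_le_supNorm hb)
        rw [h z hz, norm_mul]
        exact mul_le_of_le_one_right (norm_nonneg c) (hu.norm_le_one hz)
      -- The sharper bound applied to `u` reads `1 ≤ (1 - ‖Θ 0‖) * supNorm u ^ 2`, with `supNorm u ≤
      -- 1`.
      have hΘ0 : ‖Θ 0‖ = 0 := by
        have h1 := ModelSpace.hardyNorm_sq_le hΘ huΘ hu.1
        have h2 : ModelSpace.supNorm u ≤ 1 := ModelSpace.supNorm_le fun z hz => hu.norm_le_one hz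
        have h3 := ModelSpace.supNorm_nonneg u
        rw [hu.hardyNorm_eq_one] at h1
        nlinarith [mul_le_one₀ h2 h3 h2]
      rw [hn, hs, hΘ0]
      simp
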